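/- Let $\mathbb{Q}\langle X_n\rangle$ be the algebra of noncommutative polynomials in $x_1,\dots,x_n$ over $\mathbb{Q}$, and order words over $[n]=\{1,\dots,n\}$ lexicographically (a proper prefix is smaller). A Lyndon word is a nonempty word that is smaller than each of its proper nonempty suffixes; every word has a unique factorization $w=\ell_1\ell_2\cdots\ell_k$ into Lyndon words with $\ell_1\ge\ell_2\ge\cdots\ge\ell_k$. Put $P_a=x_a$ for a letter $a$, and $P_\ell=[P_u,P_v]=P_uP_v-P_vP_u$ for a Lyndon word $\ell=uv$ of length at least $2$, where $v$ is the lexicographically smallest proper nonempty suffix of $\ell$; for any word put $P_w=P_{\ell_1}P_{\ell_2}\cdots P_{\ell_k}$. Let $M(w)$ be the shuffle product of the Lyndon factors of $w$ of length $1$, taken with multiplicity (each such factor $a$ being read as the variable $x_a$), let $L(w)=P_{w'}$, where $w'$ is the product in decreasing order of the Lyndon factors of $w$ of length greater than $1$, and let $H_w=M(w)L(w)$. Theorem. Let $w\in[n]^r$, and let $m(w)$ be the number of Lyndon factors of $w$ of length $1$, counted with multiplicity. Then $$H_w=m(w)!\,P_w+\sum_u c_u P_u ,$$ where the sum is over words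 $u\in[n]^r$ lexicographically smaller than $w$ and all $c_u\ge 0$. Moreover, for every $r\ge 0$, $\{H_w\}_{w\in[n]^r}$ is a basis of the space of homogeneous noncommutative polynomials of degree $r$ in $\mathbb{Q}\langle X_n\rangle$. -/

import Mathlib

namespace HybridBasis

/-! ### Lyndon words

Words over an alphabet are lists, compared by the lexicographic order `<` on lists, for which a
proper prefix of a word is smaller than the word. -/

section Words

variable {α : Type*} [LinearOrder α]

/-- A Lyndon word: a nonempty word that is smaller than each of its proper nonempty suffixes. -/
def IsLyndon (w : List α) : Prop :=
  w ≠ [] ∧ ∀ u v : List α, u ≠ [] → v ≠ [] → w = u ++ v → w < v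

/-- `fs` is a factorization of `w` into a weakly decreasing product of Lyndon words. -/
def IsLyndonFactorization (w : List α) (fs : List (List α)) : Prop :=
  fs.flatten = w ∧ (∀ f ∈ fs, IsLyndon f) ∧ fs.Pairwise (fun f g => g ≤ f)

theorem append_lt_append_of_not_prefix {u v : List α} (h : u < v) (hp : ¬ u <+: v)
    (x y : List α) : u ++ x < v ++ y := by
  induction u generalizing v with
  | nil => exact absurd List.nil_prefix hp
  | cons a u ih =>
    cases v with
    | nil => exact absurd h (List.not_lt_nil _)
    | cons b v =>
      rw [List.cons_lt_cons_iff] at h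
      rw [List.cons_append, List.cons_append, List.cons_lt_cons_iff]
      rcases h with h | ⟨rfl, h⟩
      · exact Or.inl h
      · refine Or.inr ⟨rfl, ih h fun hq => hp ?_⟩
        exact (List.prefix_cons_inj a).2 hq

theorem append_lt_append_left' (u : List α) {v w : List α} (h : v < w) : u ++ v < u ++ w := by
  induction u with
  | nil => exact h
  | cons a u ih =>
    rw [List.cons_append, List.cons_append, List.cons_lt_cons_iff]
    exact Or.inr ⟨rfl, ih⟩

theorem lt_append_right' (u : List α) {v : List α} (h : v ≠ []) : u < u ++ v := by
  induction u with
  | nil =>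
    cases v with
    | nil => exact absurd rfl h
    | cons b v => exact List.nil_lt_cons b v
  | cons a u ih =>
    rw [List.cons_append, List.cons_lt_cons_iff]
    exact Or.inr ⟨rfl, ih⟩

theorem IsLyndon.append {u v : List α} (hu : IsLyndon u) (hv : IsLyndon v) (h : u < v) :
    IsLyndon (u ++ v) := by
  have key : u ++ v < v := by
    by_cases hp : u <+: v
    · obtain ⟨t, rfl⟩ := hp
      have ht : t ≠ [] := by
        rintro rfl
        simp at h
      exact append_lt_append_left' u (hv.2 u t hu.1 ht rfl)
    · simpa using append_lt_append_of_not_prefix h hp v []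
  refine ⟨by simp [hu.1], fun p s hp hs hps => ?_⟩
  rcases List.append_eq_append_iff.1 hps with ⟨a, ha, hb⟩ | ⟨a, ha, hb⟩
  · by_cases ha0 : a = []
    · subst ha0
      simp only [List.nil_append] at hb
      exact hb ▸ key
    · exact key.trans (hv.2 a s ha0 hs hb)
  · by_cases ha0 : a = []
    · subst ha0
      simp only [List.nil_append] at hb
      exact hb ▸ key
    · rw [hb]
      refine append_lt_append_of_not_prefix (hu.2 p a hp ha0 ha) (fun hq => ?_) _ _
      have h1 := hq.length_le
      have h2 := List.length_pos_of_ne_nil hp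
      rw [ha, List.length_append] at h1
      omega

theorem isLyndon_singleton (a : α) : IsLyndon [a] := by
  refine ⟨by simp, fun u v hu hv h => ?_⟩
  have h1 := congrArg List.length h
  have h2 := List.length_pos_of_ne_nil hu
  have h3 := List.length_pos_of_ne_nil hv
  simp only [List.length_append, List.length_cons, List.length_nil] at h1
  omega

theorem exists_factorization_append (fs : List (List α)) (l w : List α) (hl : IsLyndon l)
    (h : IsLyndonFactorization w fs) : ∃ gs, IsLyndonFactorization (l ++ w) gs := by
  induction fs generalizing l w with
  | nil =>
    obtain ⟨rfl, -, -⟩ := h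
    exact ⟨[l], by simp, by simpa using hl, by simp⟩
  | cons f fs ih =>
    obtain ⟨rfl, hL, hs⟩ := h
    rw [List.pairwise_cons] at hs
    by_cases hlf : l < f
    · have := ih (l ++ f) fs.flatten (hl.append (hL f (by simp)) hlf)
        ⟨rfl, fun g hg => hL g (by simp [hg]), hs.2⟩
      simpa using this
    · refine ⟨l :: f :: fs, by simp, ?_, ?_⟩
      · intro g hg
        rcases List.mem_cons.1 hg with rfl | hg
        · exact hl
        · exact hL g hg
      · refine List.pairwise_cons.2 ⟨fun g hg => ?_, List.pairwise_cons.2 hs⟩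
        rcases List.mem_cons.1 hg with rfl | hg
        · exact not_lt.1 hlf
        · exact (hs.1 g hg).trans (not_lt.1 hlf)

theorem exists_lyndonFactorization (w : List α) : ∃ fs, IsLyndonFactorization w fs := by
  induction w with
  | nil => exact ⟨[], by simp [IsLyndonFactorization]⟩
  | cons a w ih =>
    obtain ⟨fs, h⟩ := ih
    exact exists_factorization_append fs [a] w (isLyndon_singleton a) h

theorem exists_suffix_le (f : List α) (fs : List (List α)) (hf : ∀ g ∈ fs, g ≤ f)
    (t : List α) (ht : t ≠ []) (h : t <+: fs.flatten) : ∃ s, s ≠ [] ∧ s <:+ t ∧ s ≤ f := by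
  induction fs generalizing t with
  | nil => exact absurd (List.prefix_nil.1 (by simpa using h)) ht
  | cons g fs ih =>
    obtain ⟨r, hr⟩ := h
    rw [List.flatten_cons] at hr
    rcases List.append_eq_append_iff.1 hr with ⟨a, ha, hb⟩ | ⟨a, ha, hb⟩
    · refine ⟨t, ht, List.suffix_rfl, le_trans ?_ (hf g (by simp))⟩
      by_cases ha0 : a = []
      · subst ha0
        simp [ha]
      · rw [ha]
        exact (lt_append_right' t ha0).le
    · by_cases ha0 : a = []
      · subst ha0
        simp only [List.append_nil] at ha
        exact ⟨t, ht, List.suffix_rfl, ha ▸ hf g (by simp)⟩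
      · obtain ⟨s, hs, hsa, hsf⟩ :=
          ih (fun g hg => hf g (by simp [hg])) a ha0 ⟨r, hb.symm⟩
        exact ⟨s, hs, hsa.trans ⟨g, ha.symm⟩, hsf⟩

theorem first_factor_length_le {f g : List α} {fs gs : List (List α)} {w : List α}
    (hf : IsLyndonFactorization w (f :: fs)) (hg : IsLyndonFactorization w (g :: gs)) :
    g.length ≤ f.length := by
  by_contra hlt
  rw [not_le] at hlt
  obtain ⟨hfw, hfL, hfs⟩ := hf
  obtain ⟨hgw, hgL, -⟩ := hg
  rw [List.flatten_cons] at hfw hgw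
  rw [List.pairwise_cons] at hfs
  have hf0 : f ≠ [] := (hfL f (by simp)).1
  obtain ⟨t, rfl⟩ : f <+: g :=
    List.prefix_of_prefix_length_le ⟨_, hfw⟩ ⟨_, hgw⟩ hlt.le
  have ht : t ≠ [] := by
    rintro rfl
    simp at hlt
  have htp : t <+: fs.flatten := by
    refine ⟨gs.flatten, ?_⟩
    rw [← hgw, List.append_assoc] at hfw
    exact (List.append_cancel_left hfw).symm
  obtain ⟨s, hs, ⟨p, rfl⟩, hsf⟩ := exists_suffix_le f fs hfs.1 t ht htp
  have h1 : f ++ (p ++ s) < s :=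
    (hgL _ (by simp)).2 (f ++ p) s (by simp [hf0]) hs (by simp)
  exact absurd (h1.trans_le hsf) (lt_append_right' f ht).not_gt

theorem lyndonFactorization_unique {w : List α} {fs gs : List (List α)}
    (hf : IsLyndonFactorization w fs) (hg : IsLyndonFactorization w gs) : fs = gs := by
  induction fs generalizing w gs with
  | nil =>
    cases gs with
    | nil => rfl
    | cons g gs =>
      have h := hf.1.trans hg.1.symm
      have h0 := (hg.2.1 g (by simp)).1
      simp [h0] at h
  | cons f fs ih =>
    cases gs with
    | nil =>
      have h := hf.1.trans hg.1.symm
      have h0 := (hf.2.1 f (by simp)).1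
      simp [h0] at h
    | cons g gs =>
      have hlen := le_antisymm (first_factor_length_le hg hf) (first_factor_length_le hf hg)
      have h : f ++ fs.flatten = g ++ gs.flatten := by
        simpa using hf.1.trans hg.1.symm
      obtain ⟨rfl, h2⟩ := List.append_inj h hlen
      congr 1
      exact ih ⟨rfl, fun x hx => hf.2.1 x (by simp [hx]), (List.pairwise_cons.1 hf.2.2).2⟩
        ⟨h2.symm, fun x hx => hg.2.1 x (by simp [hx]), (List.pairwise_cons.1 hg.2.2).2⟩

/-- The factors `ℓ₁ ≥ ℓ₂ ≥ ⋯ ≥ ℓₖ` of the unique factorization of `w` into a weakly decreasing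
product of Lyndon words, listed with multiplicity. -/
noncomputable def lyndonFactors (w : List α) : List (List α) :=
  (exists_lyndonFactorization w).choose

theorem lyndonFactors_spec (w : List α) : IsLyndonFactorization w (lyndonFactors w) :=
  (exists_lyndonFactorization w).choose_spec

theorem lyndonFactors_eq {w : List α} {fs : List (List α)} (h : IsLyndonFactorization w fs) :
    lyndonFactors w = fs :=
  lyndonFactorization_unique (lyndonFactors_spec w) h

/-- The lexicographically smallest nonempty suffix of a nonempty word (the empty word for the
empty word). -/
def minSuffix : List α → List α
  | [] => []
  | [a] => [a]
  | a :: b :: l => min (a :: b :: l) (minSuffix (b :: l))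

theorem minSuffix_suffix (w : List α) : minSuffix w <:+ w := by
  fun_induction minSuffix w with
  | case1 => exact List.suffix_rfl
  | case2 => exact List.suffix_rfl
  | case3 a b l ih =>
    rcases min_choice (a :: b :: l) (minSuffix (b :: l)) with h | h
    · rw [h]
    · rw [h]
      exact ih.trans (List.suffix_cons a _)

theorem minSuffix_ne_nil {w : List α} (hw : w ≠ []) : minSuffix w ≠ [] := by
  fun_induction minSuffix w with
  | case1 => exact hw
  | case2 => exact hw
  | case3 a b l ih =>
    rcases min_choice (a :: b :: l) (minSuffix (b :: l)) with h | h
    · rw [h]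
      exact hw
    · rw [h]
      exact ih (by simp)

theorem minSuffix_le {w s : List α} (hs : s ≠ []) (h : s <:+ w) : minSuffix w ≤ s := by
  fun_induction minSuffix w with
  | case1 => exact absurd (List.suffix_nil.1 h) hs
  | case2 a =>
    rcases List.suffix_cons_iff.1 h with rfl | h
    · exact le_rfl
    · exact absurd (List.suffix_nil.1 h) hs
  | case3 a b l ih =>
    rcases List.suffix_cons_iff.1 h with rfl | h
    · exact min_le_left _ _
    · exact (min_le_right _ _).trans (ih h)

/-- The second factor `v` of the standard factorization `ℓ = uv`: the smallest proper nonempty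
suffix of `ℓ`. -/
def standardRight (l : List α) : List α := minSuffix l.tail

/-- The first factor `u` of the standard factorization `ℓ = uv`. -/
def standardLeft (l : List α) : List α := l.take (l.length - (standardRight l).length)

theorem standardLeft_append_standardRight (l : List α) :
    standardLeft l ++ standardRight l = l := by
  have h : standardRight l <:+ l := (minSuffix_suffix _).trans (List.tail_suffix l)
  obtain ⟨t, ht⟩ := h
  have : standardLeft l = t := by
    unfold standardLeft
    conv_lhs => rw [← ht]
    have : (t ++ standardRight l).length - (standardRight (t ++ standardRight l)).length
        = t.length := by
      rw [ht]
      have := congrArg List.length ht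
      rw [List.length_append] at this
      omega
    rw [this, List.take_left']
    rfl
  rw [this, ht]

theorem standardRight_length_lt (a b : α) (l : List α) :
    (standardRight (a :: b :: l)).length < (a :: b :: l).length := by
  have := (minSuffix_suffix (b :: l)).length_le
  simp only [standardRight, List.tail_cons, List.length_cons] at this ⊢
  omega

theorem standardLeft_length_lt (a b : α) (l : List α) :
    (standardLeft (a :: b :: l)).length < (a :: b :: l).length := by
  have h0 := List.length_pos_of_ne_nil (minSuffix_ne_nil (w := b :: l) (by simp))
  simp only [standardLeft, standardRight, List.tail_cons, List.length_take, List.length_cons]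
  omega

end Words

/-- All shuffles of two words, listed with multiplicity (one entry for each choice of the set of
positions that the letters of the first word occupy). -/
def shuffleWords {α : Type*} : List α → List α → List (List α)
  | [], v => [v]
  | a :: u, [] => [a :: u]
  | a :: u, b :: v =>
      (shuffleWords u (b :: v)).map (List.cons a) ++ (shuffleWords (a :: u) v).map (List.cons b)
termination_by u v => u.length + v.length

/-! ### Noncommutative polynomials

`FreeAlgebra ℚ (Fin n)` is the algebra of noncommutative polynomials in `n` variables. -/

variable {n : ℕ}

/-- The noncommutative monomial `x_{w₁} x_{w₂} ⋯ x_{w_r}` of a word `w`. -/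
noncomputable def monomial (w : List (Fin n)) : FreeAlgebra ℚ (Fin n) :=
  (w.map (FreeAlgebra.ι ℚ)).prod

/-- The shuffle product: the bilinear operation whose value at two monomials is the sum of all
shuffles of the two words. -/
noncomputable def shuffle :
    FreeAlgebra ℚ (Fin n) →ₗ[ℚ] FreeAlgebra ℚ (Fin n) →ₗ[ℚ] FreeAlgebra ℚ (Fin n) :=
  (FreeAlgebra.basisFreeMonoid ℚ (Fin n)).constr ℚ fun u =>
    (FreeAlgebra.basisFreeMonoid ℚ (Fin n)).constr ℚ fun v =>
      ((shuffleWords (FreeMonoid.toList u) (FreeMonoid.toList v)).map monomial).sum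

theorem basisFreeMonoid_eq_monomial (u : List (Fin n)) :
    FreeAlgebra.basisFreeMonoid ℚ (Fin n) (FreeMonoid.ofList u) = monomial u := by
  simp [FreeAlgebra.basisFreeMonoid, FreeAlgebra.equivMonoidAlgebraFreeMonoid, monomial,
    FreeMonoid.lift_apply]

theorem shuffle_monomial (u v : List (Fin n)) :
    shuffle (monomial u) (monomial v) = ((shuffleWords u v).map monomial).sum := by
  rw [← basisFreeMonoid_eq_monomial u, ← basisFreeMonoid_eq_monomial v, shuffle,
    Module.Basis.constr_basis, Module.Basis.constr_basis]
  rfl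

/-- The bracket polynomial `P_ℓ` of a Lyndon word `ℓ`: `P_a = x_a` for a letter `a`, and
`P_ℓ = [P_u, P_v] = P_u P_v - P_v P_u` if `ℓ = uv` is the standard factorization.
(The value at the empty word, which is not Lyndon, is immaterial.) -/
noncomputable def lyndonBracket : List (Fin n) → FreeAlgebra ℚ (Fin n)
  | [] => 0
  | [a] => FreeAlgebra.ι ℚ a
  | a :: b :: l =>
      lyndonBracket (standardLeft (a :: b :: l)) * lyndonBracket (standardRight (a :: b :: l)) -
        lyndonBracket (standardRight (a :: b :: l)) * lyndonBracket (standardLeft (a :: b :: l))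
termination_by l => l.length
decreasing_by
  all_goals first
    | exact standardLeft_length_lt a b l
    | exact standardRight_length_lt a b l

/-- The element `P_w = P_{ℓ₁} P_{ℓ₂} ⋯ P_{ℓₖ}` of the bracket basis, where
`w = ℓ₁ ℓ₂ ⋯ ℓₖ` is the decreasing Lyndon factorization of `w`. -/
noncomputable def bracketElement (w : List (Fin n)) : FreeAlgebra ℚ (Fin n) :=
  ((lyndonFactors w).map lyndonBracket).prod

/-- The Lyndon factors of `w` of length `1`, with multiplicity. -/
noncomputable def letterFactors (w : List (Fin n)) : List (List (Fin n)) :=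
  (lyndonFactors w).filter fun f => f.length = 1

/-- The Lyndon factors of `w` of length greater than `1`, with multiplicity, in decreasing
order. -/
noncomputable def longFactors (w : List (Fin n)) : List (List (Fin n)) :=
  (lyndonFactors w).filter fun f => 1 < f.length

/-- `M(w)`: the shuffle product of the Lyndon factors of `w` of length `1`. -/
noncomputable def shufflePart (w : List (Fin n)) : FreeAlgebra ℚ (Fin n) :=
  ((letterFactors w).map monomial).foldr (fun p q => shuffle p q) 1

/-- `L(w) = P_{w'}`, where `w'` is the product of the Lyndon factors of `w` of length greater
than `1`, in decreasing order. -/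
noncomputable def liePart (w : List (Fin n)) : FreeAlgebra ℚ (Fin n) :=
  bracketElement (longFactors w).flatten

/-- The hybrid element `H_w = M(w) L(w)`. -/
noncomputable def hybridElement (w : List (Fin n)) : FreeAlgebra ℚ (Fin n) :=
  shufflePart w * liePart w

/-- The space of homogeneous noncommutative polynomials of degree `r`: the span of the monomials
of the words of length `r`. -/
noncomputable def degreePart (n r : ℕ) : Submodule ℚ (FreeAlgebra ℚ (Fin n)) :=
  Submodule.span ℚ (monomial '' {w : List (Fin n) | w.length = r})

end HybridBasis

/-! The engine is straightening. In a product of brackets over a standard sequence of Lyndon words,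
take the last rise `a < b` and write `P_a P_b = P_b P_a + P_{ab}`. Standardness makes `(a, b)` the
standard factorization of `ab` (`lyndonBracket_append`), and both resulting sequences are again
standard (`IsStandard.swap`, `IsStandard.merge`). The swap keeps the multiset of factors; the merge
makes the concatenation of the decreasing rearrangement strictly smaller
(`flatten_sortDesc_merge_lt`). No minus sign occurs, so the product equals `P` of the decreasing
rearrangement plus a nonnegative combination of smaller terms (`IsStandard.hasLeadingTerm_prod`).

`M(w)` is a sum of `m(w)!` arrangements of the letter factors. Any such arrangement followed by the
long factors in decreasing order is a standard sequence whose decreasing rearrangement is the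
factorization of `w`; summing gives the expansion of `H_w`.

Straightening also puts every monomial in the span of the `P_u`, and triangularity with diagonal
`m(w)! ≠ 0` puts these in the span of the `H_u`. A dimension count finishes the proof. -/

namespace HybridBasis

section Lists

variable {α : Type*}

theorem length_flatten_perm {s t : List (List α)} (h : s.Perm t) :
    s.flatten.length = t.flatten.length :=
  h.flatten.length_eq

theorem filter_append_filter_not_perm (fs : List (List α)) (h : ∀ f ∈ fs, f ≠ []) :
    ((fs.filter fun f => f.length = 1) ++ fs.filter fun f => 1 < f.length).Perm fs := by
  have h1 : (fs.filter fun f => 1 < f.length) = fs.filter fun f => !decide (f.length = 1) := by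
    refine List.filter_congr fun f hf => ?_
    have := List.length_pos_of_ne_nil (h f hf)
    by_cases h1 : f.length = 1
    · simp [h1]
    · simp [h1]
      omega
  rw [h1]
  exact List.filter_append_perm _ fs

end Lists

/-! ### Standard sequences of Lyndon words and their rearrangements -/

section Words

variable {α : Type*} [LinearOrder α]

theorem IsLyndon.append_lt {u v : List α} (hu : IsLyndon u) (hv : IsLyndon v) (h : u < v) :
    u ++ v < v :=
  (hu.append hv h).2 u v hu.1 hv.1 rfl

/-- Here `uv < v < vu`. As `uv` and `vu` have equal length, neither is a proper prefix of the other,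
so the inequality survives any continuation. -/
theorem append_append_lt_append_append {u v : List α} (hu : IsLyndon u) (hv : IsLyndon v)
    (h : u < v) (p q : List α) : p ++ (u ++ v ++ q) < p ++ (v ++ u ++ q) := by
  have h1 : u ++ v < v ++ u := (hu.append_lt hv h).trans (lt_append_right' v hu.1)
  refine append_lt_append_left' p (append_lt_append_of_not_prefix h1 (fun hp => ?_) q q)
  exact h1.ne (hp.eq_of_length (by simp [Nat.add_comm]))

theorem flatten_swap_lt {u v : List α} (hu : IsLyndon u) (hv : IsLyndon v) (h : u < v)
    (p q : List (List α)) :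
    (p ++ u :: v :: q).flatten < (p ++ v :: u :: q).flatten := by
  simpa using append_append_lt_append_append hu hv h p.flatten q.flatten

/-- A list that is not weakly decreasing has a last rise. -/
theorem exists_last_rise {β : Type*} [LinearOrder β] (s : List β)
    (h : ¬ s.Pairwise (fun f g => g ≤ f)) :
    ∃ p a b q, s = p ++ a :: b :: q ∧ a < b ∧ ∀ x ∈ q, x ≤ b := by
  induction s with
  | nil => simp at h
  | cons x t ih =>
    by_cases ht : t.Pairwise (fun f g => g ≤ f)
    · cases t with
      | nil => simp at h
      | cons b q =>
        refine ⟨[], x, b, q, rfl, lt_of_not_ge fun hbx => h ?_, (List.pairwise_cons.1 ht).1⟩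
        refine List.pairwise_cons.2 ⟨fun y hy => ?_, ht⟩
        rcases List.mem_cons.1 hy with rfl | hy
        · exact hbx
        · exact ((List.pairwise_cons.1 ht).1 y hy).trans hbx
    · obtain ⟨p, a, b, q, rfl, hab, hq⟩ := ih ht
      exact ⟨x :: p, a, b, q, rfl, hab, hq⟩

theorem lt_standardRight {l : List α} (hl : IsLyndon l) (h2 : 2 ≤ l.length) :
    l < standardRight l := by
  match l, h2 with
  | a :: b :: t, _ =>
    have h := standardLeft_append_standardRight (a :: b :: t)
    have hr : standardRight (a :: b :: t) ≠ [] := minSuffix_ne_nil (by simp)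
    refine hl.2 _ _ (fun h0 => ?_) hr h.symm
    have h1 := standardRight_length_lt a b t
    rw [h0, List.nil_append] at h
    rw [h] at h1
    exact h1.false

/-- A proper suffix of `uv` longer than `v` is `cv` with `c` a proper nonempty suffix of `u`, and `v
≤ standardRight u ≤ c < cv`. A shorter nonempty one is a proper suffix of the Lyndon word `v`, hence
larger than `v`. -/
theorem standardRight_append {u v : List α} (hu : IsLyndon u) (hv : IsLyndon v)
    (h : 2 ≤ u.length → v ≤ standardRight u) : standardRight (u ++ v) = v := by
  obtain ⟨a, t, rfl⟩ := List.exists_cons_of_ne_nil hu.1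
  change minSuffix (t ++ v) = v
  have hne : t ++ v ≠ [] := by simp [hv.1]
  refine le_antisymm (minSuffix_le hv.1 (List.suffix_append t v)) ?_
  obtain ⟨p, hp⟩ := minSuffix_suffix (t ++ v)
  have hs := minSuffix_ne_nil hne
  generalize minSuffix (t ++ v) = s at hp hs
  rcases List.append_eq_append_iff.1 hp with ⟨c, hc, hd⟩ | ⟨c, hc, hd⟩
  · by_cases hc0 : c = []
    · simp [hd, hc0]
    · have h2 : 2 ≤ (a :: t).length := by
        have := List.length_pos_of_ne_nil hc0
        rw [hc]
        simp
        omega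
      rw [hd]
      exact (h h2).trans ((minSuffix_le hc0 ⟨p, hc.symm⟩).trans (lt_append_right' c hv.1).le)
  · by_cases hc0 : c = []
    · simp [hd, hc0]
    · exact (hv.2 c s hc0 hs hd).le

theorem standardLeft_append {u v : List α} (hu : IsLyndon u) (hv : IsLyndon v)
    (h : 2 ≤ u.length → v ≤ standardRight u) : standardLeft (u ++ v) = u := by
  have h1 := standardLeft_append_standardRight (u ++ v)
  rw [standardRight_append hu hv h] at h1
  exact List.append_cancel_right h1

/-- A standard sequence of Lyndon words: the right factor of the standard factorization of each
of its words is at least every later word. -/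
def IsStandard (s : List (List α)) : Prop :=
  (∀ f ∈ s, IsLyndon f) ∧ s.Pairwise fun f g => 2 ≤ f.length → g ≤ standardRight f

/-- The only new condition is on the pair `(v, u)`, and `u < v < standardRight v` when `v` is not a
letter. -/
theorem IsStandard.swap {p q : List (List α)} {u v : List α}
    (hs : IsStandard (p ++ u :: v :: q)) (h : u < v) : IsStandard (p ++ v :: u :: q) := by
  obtain ⟨hL, hP⟩ := hs
  refine ⟨fun f hf => hL f (by simp at hf ⊢; tauto), ?_⟩
  simp only [List.pairwise_append, List.pairwise_cons, List.mem_cons, forall_eq_or_imp] at hP ⊢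
  obtain ⟨h1, ⟨⟨h2, h3⟩, h4, h5⟩, h6⟩ := hP
  refine ⟨h1, ⟨⟨fun hv => ?_, h4⟩, h3, h5⟩, fun f hf => ?_⟩
  · exact (h.trans (lt_standardRight (hL v (by simp)) hv)).le
  · obtain ⟨h7, h8, h9⟩ := h6 f hf
    exact ⟨h8, h7, h9⟩

/-- The right factor of `uv` is `v`, so `hq`, which holds at the last rise, gives the condition on
later words. For earlier words, `uv < v` only weakens what `v` had to satisfy. -/
theorem IsStandard.merge {p q : List (List α)} {u v : List α}
    (hs : IsStandard (p ++ u :: v :: q)) (h : u < v) (hq : ∀ x ∈ q, x ≤ v) :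
    IsStandard (p ++ (u ++ v) :: q) := by
  obtain ⟨hL, hP⟩ := hs
  have hu : IsLyndon u := hL u (by simp)
  have hv : IsLyndon v := hL v (by simp)
  simp only [List.pairwise_append, List.pairwise_cons, List.mem_cons, forall_eq_or_imp] at hP
  obtain ⟨h1, ⟨⟨h2, h3⟩, h4, h5⟩, h6⟩ := hP
  refine ⟨fun f hf => ?_, ?_⟩
  · rw [List.mem_append, List.mem_cons] at hf
    rcases hf with hf | rfl | hf
    · exact hL f (by simp [hf])
    · exact hu.append hv h
    · exact hL f (by simp [hf])
  · simp only [List.pairwise_append, List.pairwise_cons, List.mem_cons, forall_eq_or_imp]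
    refine ⟨h1, ⟨fun x hx _ => ?_, h5⟩, fun f hf => ?_⟩
    · rw [standardRight_append hu hv h2]
      exact hq x hx
    · obtain ⟨h7, h8, h9⟩ := h6 f hf
      exact ⟨fun hf2 => (hu.append_lt hv h).le.trans (h8 hf2), h9⟩

theorem isStandard_of_letters_append {v : List α} {s : List (List α)}
    (hL : ∀ f ∈ s, IsLyndon f) (hs : s.Pairwise fun f g => g ≤ f) :
    IsStandard (v.map (fun a => [a]) ++ s) := by
  refine ⟨fun f hf => ?_, ?_⟩
  · rcases List.mem_append.1 hf with hf | hf
    · obtain ⟨a, -, rfl⟩ := List.mem_map.1 hf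
      exact isLyndon_singleton a
    · exact hL f hf
  · refine List.pairwise_append.2 ⟨?_, ?_, ?_⟩
    · exact List.pairwise_map.2 (List.pairwise_of_forall fun a b h => by simp at h)
    · exact hs.imp_of_mem fun hf _ hgf h2 => hgf.trans (lt_standardRight (hL _ hf) h2).le
    · intro f hf g _ h
      obtain ⟨a, -, rfl⟩ := List.mem_map.1 hf
      simp at h

/-- The weakly decreasing rearrangement of a list of words. -/
def sortDesc (s : List (List α)) : List (List α) := s.insertionSort fun f g => g ≤ f

theorem sortDesc_perm (s : List (List α)) : (sortDesc s).Perm s :=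
  List.perm_insertionSort _ s

theorem sortDesc_pairwise (s : List (List α)) : (sortDesc s).Pairwise fun f g => g ≤ f :=
  List.pairwise_insertionSort (fun f g : List α => g ≤ f) s

theorem sortDesc_eq {s t : List (List α)} (h : t.Perm s)
    (ht : t.Pairwise fun f g => g ≤ f) : sortDesc s = t :=
  ((sortDesc_perm s).trans h.symm).eq_of_pairwise
    (fun _ _ _ _ h1 h2 => le_antisymm h2 h1) (sortDesc_pairwise s) ht

/-- Induction on the words of a fixed length, from larger words to smaller ones. -/
theorem word_induction_gt [Finite α] {r : ℕ} {C : List α → Prop}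
    (h : ∀ w, w.length = r → (∀ u, u.length = r → w < u → C u) → C w) (w : List α)
    (hw : w.length = r) : C w := by
  have : Finite {w : List α // w.length = r} := (List.finite_length_eq α r).to_subtype
  have key : ∀ w : {w : List α // w.length = r}, C w.1 := fun w =>
    (wellFounded_gt (α := {w : List α // w.length = r})).induction w fun x ih =>
      h x.1 x.2 fun u hu hxu => ih ⟨u, hu⟩ hxu
  exact key ⟨w, hw⟩

/-- Induction on the words of a fixed length, from smaller words to larger ones. -/
theorem word_induction_lt [Finite α] {r : ℕ} {C : List α → Prop}
    (h : ∀ w, w.length = r → (∀ u, u.length = r → u < w → C u) → C w) (w : List α)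
    (hw : w.length = r) : C w := by
  have : Finite {w : List α // w.length = r} := (List.finite_length_eq α r).to_subtype
  have key : ∀ w : {w : List α // w.length = r}, C w.1 := fun w =>
    (wellFounded_lt (α := {w : List α // w.length = r})).induction w fun x ih =>
      h x.1 x.2 fun u hu hxu => ih ⟨u, hu⟩ hxu
  exact key ⟨w, hw⟩

/-- Among the arrangements of a list of Lyndon words, the decreasing one has the largest
concatenation. -/
theorem flatten_le_flatten_sortDesc [Finite α] (s : List (List α)) (hL : ∀ f ∈ s, IsLyndon f) :
    s.flatten ≤ (sortDesc s).flatten := by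
  refine word_induction_gt (r := s.flatten.length)
    (C := fun w => ∀ t : List (List α), t.Perm s → t.flatten = w → w ≤ (sortDesc s).flatten)
    (fun w hw ih t ht htw => ?_) s.flatten rfl s (List.Perm.refl s) rfl
  by_cases hd : t.Pairwise fun f g => g ≤ f
  · rw [sortDesc_eq ht hd, htw]
  · obtain ⟨p, a, b, q, rfl, hab, -⟩ := exists_last_rise t hd
    -- Undoing a rise increases the concatenation, so the induction from larger words applies.
    have hlt := flatten_swap_lt (hL a (ht.mem_iff.1 (by simp))) (hL b (ht.mem_iff.1 (by simp)))
      hab p q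
    have hperm : (p ++ b :: a :: q).Perm s :=
      ((List.Perm.swap a b q).append_left p).trans ht
    rw [htw] at hlt
    exact hlt.le.trans (ih _ (length_flatten_perm hperm) hlt _ hperm rfl)

/-- In the sorted merged list, replace the factor `uv` by `v, u`. The concatenation grows, and the
result is an arrangement of the unmerged list, hence bounded by its decreasing arrangement. -/
theorem flatten_sortDesc_merge_lt [Finite α] {p q : List (List α)} {u v : List α}
    (hL : ∀ f ∈ p ++ u :: v :: q, IsLyndon f) (h : u < v) :
    (sortDesc (p ++ (u ++ v) :: q)).flatten < (sortDesc (p ++ u :: v :: q)).flatten := by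
  have hmem : u ++ v ∈ sortDesc (p ++ (u ++ v) :: q) :=
    (sortDesc_perm _).mem_iff.2 (by simp)
  obtain ⟨a, b, hab⟩ := List.append_of_mem hmem
  have hperm : (a ++ b).Perm (p ++ q) := by
    have h1 := sortDesc_perm (p ++ (u ++ v) :: q)
    rw [hab] at h1
    exact ((List.perm_middle.symm.trans h1).trans List.perm_middle).cons_inv
  have h2 : (a ++ v :: u :: b).Perm (p ++ u :: v :: q) :=
    (List.perm_middle.trans (List.perm_middle.cons v)).trans <|
      ((hperm.cons u).cons v).trans <| (List.Perm.swap u v _).trans <|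
        ((List.perm_middle.trans (List.perm_middle.cons u)).symm)
  have h3 := flatten_le_flatten_sortDesc (a ++ v :: u :: b)
    fun f hf => hL f (h2.mem_iff.1 hf)
  rw [sortDesc_eq ((sortDesc_perm _).trans h2.symm) (sortDesc_pairwise _)] at h3
  rw [hab]
  refine lt_of_lt_of_le ?_ h3
  simpa using flatten_swap_lt (hL u (by simp)) (hL v (by simp)) h a b

end Words

/-! ### Shuffle products of letters -/

section Shuffle

variable {α : Type*}

theorem length_shuffleWords_singleton (a : α) (v : List α) :
    (shuffleWords [a] v).length = v.length + 1 := by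
  induction v with
  | nil => simp [shuffleWords]
  | cons b v ih => simp [shuffleWords, ih, Nat.add_comm]

theorem perm_of_mem_shuffleWords_singleton (a : α) (v : List α) :
    ∀ x ∈ shuffleWords [a] v, x.Perm (a :: v) := by
  induction v with
  | nil => simp [shuffleWords]
  | cons b v ih =>
    intro x hx
    simp only [shuffleWords, List.map_cons, List.map_nil, List.mem_append, List.mem_cons,
      List.not_mem_nil, or_false, List.mem_map] at hx
    rcases hx with rfl | ⟨y, hy, rfl⟩
    · exact List.Perm.refl _
    · exact ((ih y hy).cons b).trans (List.Perm.swap a b v)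

end Shuffle

variable {n : ℕ}

theorem monomial_append (u v : List (Fin n)) : monomial (u ++ v) = monomial u * monomial v := by
  simp [monomial]

theorem prod_lyndonBracket_letters (v : List (Fin n)) :
    ((v.map fun a => [a]).map lyndonBracket).prod = monomial v := by
  simp [monomial, Function.comp_def, lyndonBracket]

theorem shuffle_monomial_sum (u : List (Fin n)) (L : List (List (Fin n))) :
    shuffle (monomial u) (L.map monomial).sum =
      ((L.flatMap (shuffleWords u)).map monomial).sum := by
  induction L with
  | nil => simp
  | cons v L ih => simp [shuffle_monomial, ih]

/-- The shuffle product of `k` letters is the sum of `k!` of their arrangements. -/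
theorem exists_foldr_shuffle (v : List (Fin n)) :
    ∃ L : List (List (Fin n)), L.length = v.length.factorial ∧ (∀ x ∈ L, x.Perm v) ∧
      ((v.map fun a => [a]).map monomial).foldr (fun p q => shuffle p q) 1 =
        (L.map monomial).sum := by
  induction v with
  | nil => exact ⟨[[]], by simp [monomial]⟩
  | cons a v ih =>
    obtain ⟨L, hlen, hperm, hsum⟩ := ih
    refine ⟨L.flatMap (shuffleWords [a]), ?_, fun x hx => ?_, ?_⟩
    · have h1 : L.map (fun x => (shuffleWords [a] x).length) = L.map fun _ => v.length + 1 :=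
        List.map_congr_left fun x hx => by
          rw [length_shuffleWords_singleton, (hperm x hx).length_eq]
      rw [List.length_flatMap, h1]
      simp [hlen, Nat.factorial_succ, Nat.mul_comm]
    · obtain ⟨y, hy, hxy⟩ := List.mem_flatMap.1 hx
      exact (perm_of_mem_shuffleWords_singleton a y x hxy).trans ((hperm y hy).cons a)
    · rw [← shuffle_monomial_sum, ← hsum]
      simp

/-! ### Triangular expansions and straightening -/

/-- `x` is `k P_w` plus a nonnegative combination of elements `P_u` for words `u` that have the
length of `w` and are smaller than `w`. -/
def HasLeadingTerm (k : ℚ) (w : List (Fin n)) (x : FreeAlgebra ℚ (Fin n)) : Prop :=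
  ∃ c : List (Fin n) →₀ ℚ, (∀ u ∈ c.support, u.length = w.length ∧ u < w) ∧ (∀ u, 0 ≤ c u) ∧
    x = k • bracketElement w + Finsupp.linearCombination ℚ bracketElement c

theorem hasLeadingTerm_bracketElement (w : List (Fin n)) :
    HasLeadingTerm 1 w (bracketElement w) :=
  ⟨0, by simp, by simp, by simp⟩

theorem hasLeadingTerm_zero (w : List (Fin n)) : HasLeadingTerm 0 w 0 :=
  ⟨0, by simp, by simp, by simp⟩

theorem HasLeadingTerm.add {k l : ℚ} {w : List (Fin n)} {x y : FreeAlgebra ℚ (Fin n)}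
    (hx : HasLeadingTerm k w x) (hy : HasLeadingTerm l w y) :
    HasLeadingTerm (k + l) w (x + y) := by
  obtain ⟨c, hc, hc0, rfl⟩ := hx
  obtain ⟨d, hd, hd0, rfl⟩ := hy
  refine ⟨c + d, fun u hu => ?_, fun u => add_nonneg (hc0 u) (hd0 u), ?_⟩
  · rcases Finset.mem_union.1 (Finsupp.support_add hu) with h | h
    · exact hc u h
    · exact hd u h
  · rw [map_add, add_smul]
    abel

theorem HasLeadingTerm.of_lt {k : ℚ} {u w : List (Fin n)} {x : FreeAlgebra ℚ (Fin n)}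
    (hx : HasLeadingTerm k u x) (hk : 0 ≤ k) (hlen : u.length = w.length) (h : u < w) :
    HasLeadingTerm 0 w x := by
  obtain ⟨c, hc, hc0, rfl⟩ := hx
  refine ⟨Finsupp.single u k + c, fun y hy => ?_, fun y => add_nonneg ?_ (hc0 y), ?_⟩
  · rcases Finset.mem_union.1 (Finsupp.support_add hy) with hy | hy
    · obtain rfl := Finset.mem_singleton.1 (Finsupp.support_single_subset hy)
      exact ⟨hlen, h⟩
    · exact ⟨(hc y hy).1.trans hlen, (hc y hy).2.trans h⟩
  · rw [Finsupp.single_apply]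
    split_ifs
    · exact hk
    · exact le_rfl
  · simp

theorem hasLeadingTerm_sum {ι : Type*} (L : List ι) (f : ι → FreeAlgebra ℚ (Fin n))
    (w : List (Fin n)) (h : ∀ i ∈ L, HasLeadingTerm 1 w (f i)) :
    HasLeadingTerm (L.length : ℚ) w (L.map f).sum := by
  induction L with
  | nil => simpa using hasLeadingTerm_zero w
  | cons i L ih =>
    have := (h i (by simp)).add (ih fun j hj => h j (by simp [hj]))
    simpa [add_comm] using this

theorem lyndonBracket_append {u v : List (Fin n)} (hu : IsLyndon u) (hv : IsLyndon v)
    (h : 2 ≤ u.length → v ≤ standardRight u) :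
    lyndonBracket (u ++ v) =
      lyndonBracket u * lyndonBracket v - lyndonBracket v * lyndonBracket u := by
  have h1 := standardLeft_append hu hv h
  have h2 := standardRight_append hu hv h
  have hlen : 2 ≤ (u ++ v).length := by
    have := List.length_pos_of_ne_nil hu.1
    have := List.length_pos_of_ne_nil hv.1
    rw [List.length_append]
    omega
  generalize u ++ v = l at h1 h2 hlen
  match l, hlen with
  | a :: b :: t, _ => rw [lyndonBracket, h1, h2]

/-- Straightening: the product of the bracket polynomials of a standard sequence. -/
theorem IsStandard.hasLeadingTerm_prod (s : List (List (Fin n))) (hs : IsStandard s) :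
    HasLeadingTerm 1 (sortDesc s).flatten (s.map lyndonBracket).prod := by
  induction hk : s.length using Nat.strong_induction_on generalizing s with
  | _ k ihk =>
  -- The outer induction on the number of factors handles merges. This inner one handles swaps,
  -- which keep that number and increase the concatenation.
  refine word_induction_gt (r := s.flatten.length)
    (C := fun w => ∀ t : List (List (Fin n)), IsStandard t → t.length = k → t.flatten = w →
      HasLeadingTerm 1 (sortDesc t).flatten (t.map lyndonBracket).prod)
    (fun w hw ih t ht htk htw => ?_) s.flatten rfl s hs hk rfl
  by_cases hd : t.Pairwise fun f g => g ≤ f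
  · have h1 : bracketElement t.flatten = (t.map lyndonBracket).prod := by
      rw [bracketElement, lyndonFactors_eq ⟨rfl, ht.1, hd⟩]
    rw [sortDesc_eq (List.Perm.refl t) hd, ← h1]
    exact hasLeadingTerm_bracketElement _
  · obtain ⟨p, a, b, q, rfl, hab, hq⟩ := exists_last_rise t hd
    have ha : IsLyndon a := ht.1 a (by simp)
    have hb : IsLyndon b := ht.1 b (by simp)
    have hstd : 2 ≤ a.length → b ≤ standardRight a := by
      have h1 := (List.pairwise_append.1 ht.2).2.1
      exact (List.pairwise_cons.1 h1).1 b (by simp)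
    have hperm : (p ++ b :: a :: q).Perm (p ++ a :: b :: q) :=
      (List.Perm.swap a b q).append_left p
    have hswap := ih _ ((length_flatten_perm hperm).trans (htw ▸ hw))
      (htw ▸ flatten_swap_lt ha hb hab p q) (p ++ b :: a :: q) (ht.swap hab)
      (by simpa using htk) rfl
    rw [sortDesc_eq ((sortDesc_perm _).trans hperm.symm) (sortDesc_pairwise _)] at hswap
    have hmerge := ihk (p ++ (a ++ b) :: q).length (by rw [← htk]; simp)
      (p ++ (a ++ b) :: q) (ht.merge hab hq) rfl
    have hlen : (sortDesc (p ++ (a ++ b) :: q)).flatten.length =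
        (sortDesc (p ++ a :: b :: q)).flatten.length := by
      rw [length_flatten_perm (sortDesc_perm _), length_flatten_perm (sortDesc_perm _)]
      simp
    have h := hswap.add
      (hmerge.of_lt zero_le_one hlen (flatten_sortDesc_merge_lt ht.1 hab))
    rw [add_zero] at h
    convert h using 1
    simp only [List.map_append, List.map_cons, List.prod_append, List.prod_cons,
      lyndonBracket_append ha hb hstd]
    noncomm_ring

theorem exists_letters (fs : List (List (Fin n))) (h : ∀ f ∈ fs, f.length = 1) :
    ∃ v : List (Fin n), fs = v.map fun a => [a] := by
  induction fs with
  | nil => exact ⟨[], rfl⟩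
  | cons f fs ih =>
    obtain ⟨v, rfl⟩ := ih fun g hg => h g (by simp [hg])
    obtain ⟨a, rfl⟩ := List.length_eq_one_iff.1 (h f (by simp))
    exact ⟨a :: v, rfl⟩

theorem hasLeadingTerm_hybridElement (w : List (Fin n)) :
    HasLeadingTerm ((letterFactors w).length.factorial : ℚ) w (hybridElement w) := by
  obtain ⟨hw, hL, hd⟩ := lyndonFactors_spec w
  have hL' : ∀ f ∈ longFactors w, IsLyndon f := fun f hf => hL f (List.mem_filter.1 hf).1
  have hd' : (longFactors w).Pairwise fun f g => g ≤ f := hd.filter _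
  have hlie : liePart w = ((longFactors w).map lyndonBracket).prod := by
    rw [liePart, bracketElement, lyndonFactors_eq ⟨rfl, hL', hd'⟩]
  obtain ⟨v, hv⟩ := exists_letters (letterFactors w) fun f hf => by
    simpa using (List.mem_filter.1 hf).2
  obtain ⟨L, hlen, hperm, hsum⟩ := exists_foldr_shuffle v
  have hH : hybridElement w = (L.map fun x => monomial x * liePart w).sum := by
    rw [hybridElement, shufflePart, hv, hsum, List.sum_map_mul_right]
  rw [hH, hv, List.length_map, ← hlen]
  -- Each of the `m(w)!` arrangements contributes `P_w` with coefficient exactly 1.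
  refine hasLeadingTerm_sum L _ w fun x hx => ?_
  have hstd := isStandard_of_letters_append (v := x) hL' hd'
  have h := hstd.hasLeadingTerm_prod
  have hp : (lyndonFactors w).Perm (x.map (fun a => [a]) ++ longFactors w) := by
    have h1 := filter_append_filter_not_perm (lyndonFactors w) fun f hf => (hL f hf).1
    change (letterFactors w ++ longFactors w).Perm _ at h1
    rw [hv] at h1
    exact h1.symm.trans (((hperm x hx).symm.map _).append_right _)
  rwa [sortDesc_eq hp hd, hw, List.map_append, List.prod_append, prod_lyndonBracket_letters,
    ← hlie] at h

theorem hasLeadingTerm_monomial (v : List (Fin n)) :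
    HasLeadingTerm 1 (sortDesc (v.map fun a => [a])).flatten (monomial v) := by
  have h := (isStandard_of_letters_append (v := v) (s := []) (by simp) (by simp)).hasLeadingTerm_prod
  rwa [List.append_nil, prod_lyndonBracket_letters] at h

/-! ### Homogeneity, spanning and the basis -/

theorem mul_mem_degreePart {r s : ℕ} {x y : FreeAlgebra ℚ (Fin n)} (hx : x ∈ degreePart n r)
    (hy : y ∈ degreePart n s) : x * y ∈ degreePart n (r + s) := by
  have h := Submodule.mul_mem_mul hx hy
  rw [degreePart, degreePart, Submodule.span_mul_span] at h
  refine Submodule.span_mono ?_ h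
  rintro _ ⟨_, ⟨u, hu, rfl⟩, _, ⟨v, hv, rfl⟩, rfl⟩
  exact ⟨u ++ v, by simp_all, monomial_append u v⟩

theorem monomial_mem_degreePart (v : List (Fin n)) : monomial v ∈ degreePart n v.length :=
  Submodule.subset_span ⟨v, rfl, rfl⟩

theorem lyndonBracket_mem_degreePart (l : List (Fin n)) :
    lyndonBracket l ∈ degreePart n l.length := by
  fun_induction lyndonBracket l with
  | case1 => exact Submodule.zero_mem _
  | case2 a => simpa [monomial] using monomial_mem_degreePart [a]
  | case3 a b l ih1 ih2 =>
    have h := congrArg List.length (standardLeft_append_standardRight (a :: b :: l))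
    rw [List.length_append] at h
    refine Submodule.sub_mem _ ?_ ?_
    · rw [← h]
      exact mul_mem_degreePart ih1 ih2
    · rw [← h, Nat.add_comm]
      exact mul_mem_degreePart ih2 ih1

theorem bracketElement_mem_degreePart (w : List (Fin n)) :
    bracketElement w ∈ degreePart n w.length := by
  have h : ∀ fs : List (List (Fin n)),
      (fs.map lyndonBracket).prod ∈ degreePart n fs.flatten.length := by
    intro fs
    induction fs with
    | nil => simpa [monomial] using monomial_mem_degreePart ([] : List (Fin n))
    | cons f fs ih =>
      rw [List.map_cons, List.prod_cons, List.flatten_cons, List.length_append]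
      exact mul_mem_degreePart (lyndonBracket_mem_degreePart f) ih
  have h1 := h (lyndonFactors w)
  rwa [(lyndonFactors_spec w).1] at h1

theorem HasLeadingTerm.mem {k : ℚ} {w : List (Fin n)} {x : FreeAlgebra ℚ (Fin n)}
    (hx : HasLeadingTerm k w x) {S : Submodule ℚ (FreeAlgebra ℚ (Fin n))}
    (h : ∀ u : List (Fin n), u.length = w.length → bracketElement u ∈ S) : x ∈ S := by
  obtain ⟨c, hc, -, rfl⟩ := hx
  refine S.add_mem (S.smul_mem _ (h w rfl)) ?_
  rw [Finsupp.linearCombination_apply]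
  exact S.sum_mem fun u hu => S.smul_mem _ (h u (hc u hu).1)

theorem hybridElement_mem_degreePart (w : List (Fin n)) :
    hybridElement w ∈ degreePart n w.length :=
  (hasLeadingTerm_hybridElement w).mem fun u hu => hu ▸ bracketElement_mem_degreePart u

/-- Inverts the triangular system from the smallest word upwards, dividing by the nonzero factorial.
-/
theorem bracketElement_mem_span_hybridElement {r : ℕ} (w : List (Fin n)) (hw : w.length = r) :
    bracketElement w ∈
      Submodule.span ℚ (Set.range fun u : {u : List (Fin n) // u.length = r} =>
        hybridElement u.1) := by
  refine word_induction_lt (C := fun w => bracketElement w ∈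
    Submodule.span ℚ (Set.range fun u : {u : List (Fin n) // u.length = r} => hybridElement u.1))
    (fun w hw ih => ?_) w hw
  obtain ⟨c, hc, -, h⟩ := hasLeadingTerm_hybridElement w
  have hk : ((letterFactors w).length.factorial : ℚ) ≠ 0 := by positivity
  rw [← Submodule.smul_mem_iff _ hk, ← sub_eq_iff_eq_add.2 h]
  refine Submodule.sub_mem _ (Submodule.subset_span ⟨⟨w, hw⟩, rfl⟩) ?_
  rw [Finsupp.linearCombination_apply]
  exact Submodule.sum_mem _ fun u hu =>
    Submodule.smul_mem _ _ (ih u ((hc u hu).1.trans hw) (hc u hu).2)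

theorem degreePart_le_span_hybridElement (r : ℕ) :
    degreePart n r ≤
      Submodule.span ℚ (Set.range fun u : {u : List (Fin n) // u.length = r} =>
        hybridElement u.1) := by
  refine Submodule.span_le.2 ?_
  rintro _ ⟨v, hv, rfl⟩
  refine (hasLeadingTerm_monomial v).mem fun u hu =>
    bracketElement_mem_span_hybridElement u (hu.trans ?_)
  rw [length_flatten_perm (sortDesc_perm _)]
  simpa [Function.comp_def] using hv

theorem linearIndependent_monomial :
    LinearIndependent ℚ (monomial : List (Fin n) → FreeAlgebra ℚ (Fin n)) := by
  have h := (FreeAlgebra.basisFreeMonoid ℚ (Fin n)).linearIndependent.comp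
    (FreeMonoid.ofList : List (Fin n) → FreeMonoid (Fin n)) FreeMonoid.ofList.injective
  have h1 : (monomial : List (Fin n) → FreeAlgebra ℚ (Fin n)) =
      FreeAlgebra.basisFreeMonoid ℚ (Fin n) ∘ FreeMonoid.ofList :=
    funext fun u => (basisFreeMonoid_eq_monomial u).symm
  rw [h1]
  exact h

noncomputable instance (r : ℕ) : Fintype {w : List (Fin n) // w.length = r} :=
  (List.finite_length_eq (Fin n) r).fintype

theorem finrank_degreePart (r : ℕ) :
    Module.finrank ℚ (degreePart n r) = Fintype.card {w : List (Fin n) // w.length = r} := by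
  have h : degreePart n r =
      Submodule.span ℚ (Set.range fun u : {u : List (Fin n) // u.length = r} =>
        monomial u.1) := by
    rw [degreePart, Set.image_eq_range]
    rfl
  rw [h]
  exact finrank_span_eq_card (linearIndependent_monomial.comp _ Subtype.val_injective)

/-- The family spans and is indexed by as many words as the dimension, so independence need not be
shown separately. -/
theorem exists_basis_hybridElement (r : ℕ) :
    ∃ b : Module.Basis {w : List (Fin n) // w.length = r} ℚ (degreePart n r),
      ∀ w, (b w : FreeAlgebra ℚ (Fin n)) = hybridElement w.1 := by
  let f : {w : List (Fin n) // w.length = r} → degreePart n r := fun w =>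
    ⟨hybridElement w.1, by simpa only [w.2] using hybridElement_mem_degreePart w.1⟩
  have hspan : ⊤ ≤ Submodule.span ℚ (Set.range f) := by
    rintro ⟨x, hx⟩ -
    have h := degreePart_le_span_hybridElement r hx
    have himg : (Set.range fun u : {u : List (Fin n) // u.length = r} => hybridElement u.1) =
        (degreePart n r).subtype '' Set.range f := by
      rw [← Set.range_comp]
      rfl
    rw [himg, ← Submodule.map_span] at h
    obtain ⟨y, hy, hyx⟩ := h
    have : y = ⟨x, hx⟩ := Subtype.ext hyx
    exact this ▸ hy
  refine ⟨basisOfTopLeSpanOfCardEqFinrank f hspan (finrank_degreePart r).symm, fun w => ?_⟩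
  rw [coe_basisOfTopLeSpanOfCardEqFinrank]

end HybridBasis

theorem mainTheorem6 (n r : ℕ) :
    (∀ w : List (Fin n), w.length = r →
      ∃ c : List (Fin n) →₀ ℚ,
        (∀ u ∈ c.support, u.length = r ∧ u < w) ∧
        (∀ u, 0 ≤ c u) ∧
        HybridBasis.hybridElement w =
          ((HybridBasis.letterFactors w).length.factorial : ℚ) • HybridBasis.bracketElement w +
            c.sum fun u q => q • HybridBasis.bracketElement u) ∧
    ∃ b : Module.Basis {w : List (Fin n) // w.length = r} ℚ (HybridBasis.degreePart n r),
      ∀ w, (b w : FreeAlgebra ℚ (Fin n)) = HybridBasis.hybridElement w.1 := by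
  refine ⟨fun w hw => ?_, HybridBasis.exists_basis_hybridElement r⟩
  obtain ⟨c, hc, hc0, h⟩ := HybridBasis.hasLeadingTerm_hybridElement w
  exact ⟨c, fun u hu => ⟨(hc u hu).1.trans hw, (hc u hu).2⟩, hc0, h⟩
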